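/- **Setting.** Let $L$ be a finite field, $\sigma,\tau$ automorphisms of $L$, $\overline\tau=\tau^{-1}$, $K$ the fixed field of $\sigma$, and $N_{L:K}$ the norm. For $\alpha,\eta\in L$ let $\mathcal S_{\sigma,\tau,\alpha,\eta}$ be $L^2$ with the multiplication $$\begin{pmatrix}x_0\\x_1\end{pmatrix}\circ\begin{pmatrix}y_0\\y_1\end{pmatrix}=\begin{pmatrix}x_1y_1^{\sigma}-\eta x_1^{\sigma}y_1+\alpha\bigl(x_0y_0^{\sigma}-\eta^{\overline\tau}x_0^{\sigma}y_0\bigr)\\ x_0^{\tau}y_1+x_1y_0^{\tau}\end{pmatrix}.$$ Call $\alpha$ *admissible* if $\alpha\neq0$ and $\alpha\notin\{x^{\sigma+1}y^{\tau-1}: x,y\in L^*\}$ (where $x^{\sigma+1}=x^\sigma x$, $y^{\tau-1}=y^\tau/y$), and call $(\alpha,\eta)$ *admissible* if $\alpha$ is admissible and $N_{L:K}(\eta)\neq1$. A *Zhou–Pott semifield* is $F^2$, for a finite field $F$ of odd characteristic, with the multiplication $$\begin{pmatrix}x_0\\x_1\end{pmatrix}\circ_{ZP}\begin{pmatrix}y_0\\y_1\end{pmatrix}=\begin{pmatrix}x_0^{\sigma'}y_0+x_0y_0^{\sigma'}+\alpha'(x_1^{\sigma'}y_1+x_1y_1^{\sigma'})^{\tau'}\\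 x_0y_1+x_1y_0\end{pmatrix},$$ where $\sigma',\tau'$ are automorphisms of $F$, $\sigma'$ has odd order and $\alpha'\in F$ is a non-square. A *(pre-)semifield* is a group $(S,+)$ with a multiplication that is distributive on both sides and has no zero divisors. Two (pre-)semifields are *isotopic* if there are additive bijections $N_1,N_2,N_3$ with $N_1(x\circ_1y)=N_2(x)\circ_2N_3(y)$ for all $x,y$. **Statement.** 1. If $(\alpha,\eta)$ is admissible, then $\mathcal S_{\sigma,\tau,\alpha,\eta}$ is a (pre-)semifield. 2. Let $\sigma^2\neq\mathrm{id}$, $\tau\neq\mathrm{id}$ and let $(\alpha,\eta)$ be admissible. Then $\mathcal S_{\sigma,\tau,\alpha,\eta}$ is isotopic to a Zhou–Pott semifield if and only if $\sigma$ has odd order and $N_{L:K}(\eta)=-1$. 3. Every Zhou–Pott semifield is isotopic to a member of the new family: if $L$ has odd characteristic, $\sigma$ has odd order and $\alpha$ is a non-square, then $(\alpha,-1)$ is admissible for $(\sigma,\overline\tau)$, and the Zhou–Pott semifield with parameters $\sigma,\tau,\alpha$ is isotopic to $\mathcal S_{\sigma,\overline\tau,\alpha,-1}$. 4. The extension is proper: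 if $L$ has odd characteristic, $\sigma^2\ne\mathrm{id}$, $\tau\neq\mathrm{id}$, and $|K|>3$ or $\sigma$ has even order, then there is an admissible pair $(\alpha,\eta)$ with $\eta\neq0$ for which $\mathcal S_{\sigma,\tau,\alpha,\eta}$ is not isotopic to any Zhou–Pott semifield. 5. The extension is vast: if $L$ has odd characteristic, $\sigma^2\ne\mathrm{id}$, $\tau\neq\mathrm{id}$, $\sigma$ has odd order and $\alpha$ is admissible, then the number of $\eta\in L^*$ with $(\alpha,\eta)$ admissible is exactly $|K|-2$ times the number of those among them for which $\mathcal S_{\sigma,\tau,\alpha,\eta}$ is isotopic to a Zhou–Pott semifield. -/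

import Mathlib

universe u

/-- A multiplication on an additive group is that of a pre-semifield: both distributive laws hold
and there are no zero divisors. -/
structure IsPresemifield {S : Type*} [AddGroup S] (mul : S → S → S) : Prop where
  left_distrib : ∀ x y z, mul x (y + z) = mul x y + mul x z
  right_distrib : ∀ x y z, mul (x + y) z = mul x z + mul y z
  eq_zero_or_eq_zero : ∀ x y, mul x y = 0 → x = 0 ∨ y = 0

/-- Isotopy of two multiplications. On elementary abelian `p`-groups the additive bijections are
exactly the `𝔽_p`-linear ones. -/
def Isotopic {S T : Type*} [AddGroup S] [AddGroup T] (f : S → S → S) (g : T → T → T) : Prop :=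
  ∃ N₁ N₂ N₃ : S ≃+ T, ∀ x y, N₁ (f x y) = g (N₂ x) (N₃ y)

/-- The fixed field of an automorphism of a field. -/
def fixedSubfield {L : Type*} [Field L] (σ : RingAut L) : Subfield L :=
  RingHom.eqLocusField (σ : L →+* L) (RingHom.id L)

/-- The relative norm from `L` to the fixed field of `σ`. -/
noncomputable def fixedNorm {L : Type*} [Field L] (σ : RingAut L) (η : L) : fixedSubfield σ :=
  Algebra.norm (fixedSubfield σ) η

/-- The Zhou–Pott multiplication on `L²`. -/
def zhouPottMul {L : Type*} [Field L] (σ τ : RingAut L) (α : L) (x y : L × L) : L × L :=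
  (σ x.1 * y.1 + x.1 * σ y.1 + α * τ (σ x.2 * y.2 + x.2 * σ y.2),
    x.1 * y.2 + x.2 * y.1)

/-- The conditions on the parameters of a Zhou–Pott semifield: odd characteristic, `σ` of odd
order, `α` a non-square. -/
structure IsZhouPottParam {L : Type*} [Field L] (σ : RingAut L) (α : L) : Prop where
  char_ne_two : ringChar L ≠ 2
  odd_order : Odd (orderOf σ)
  not_isSquare : ¬ IsSquare α

/-- `f` is isotopic to a member of the Zhou–Pott family, over any finite field `F`. -/
def IsIsotopicToZhouPott {S : Type u} [AddGroup S] (f : S → S → S) : Prop :=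
  ∃ (F : Type u) (_ : Field F) (_ : Finite F) (σ τ : RingAut F) (α : F),
    IsZhouPottParam σ α ∧ Isotopic f (zhouPottMul σ τ α)

/-- The multiplication of the family `𝒮_{σ,τ,α,η}` on `L²`. -/
def familyMul {L : Type*} [Field L] (σ τ : RingAut L) (α η : L) (x y : L × L) : L × L :=
  (x.2 * σ y.2 - η * σ x.2 * y.2 + α * (x.1 * σ y.1 - τ⁻¹ η * σ x.1 * y.1),
    τ x.1 * y.2 + x.2 * τ y.1)

/-- The condition on `α`: it is nonzero and not of the form `x^(σ+1) * y^(τ-1)`. -/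
structure IsFamilyAlpha {L : Type*} [Field L] (σ τ : RingAut L) (α : L) : Prop where
  ne_zero : α ≠ 0
  ne_mul : ∀ x y : L, x ≠ 0 → y ≠ 0 → α ≠ (σ x * x) * (τ y / y)

/-- The conditions on the parameters of the family `𝒮_{σ,τ,α,η}`. -/
structure IsFamilyParam {L : Type*} [Field L] (σ τ : RingAut L) (α η : L) : Prop where
  alpha : IsFamilyAlpha σ τ α
  norm_ne_one : fixedNorm σ η ≠ 1

/-!
If `x ∘ y = 0` with `x₀, y₀ ≠ 0`, the second coordinate forces `y₁ = u τ(y₀)` and `x₁ = -u τ(x₀)`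
for one `u`, and the first coordinate then reads `α z = u^(σ+1) z^τ` with
`z = x₀ y₀^σ - η^(τ⁻¹) x₀^σ y₀`. Here `z ≠ 0`, because `N(η) ≠ 1`; so `α` would not be admissible.

A Zhou–Pott semifield is commutative, so a multiplication `∘` isotopic to one satisfies
`A x ∘ y = A y ∘ x` for some additive bijection `A`. The second coordinate determines `A` on both
axes up to a few scalars, and independence of characters applied to the first coordinate shows
that the first coordinate `D` of `A (1, 0)` is nonzero and satisfies `-η σ(τ D) = τ D`. Hence
`N(-η) = 1`. Conversely, if `σ` has odd order and `N(η) = -1`, then Hilbert 90 writes `-η` as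
`b / σ b`, and rescaling the coordinates brings `η` to `-1`, where the family is the Zhou–Pott
family with its coordinates exchanged.
-/

section Automorphisms

theorem ringAut_apply_comm {R : Type*} [Semiring R] {σ τ : RingAut R} (h : Commute σ τ) (x : R) :
    σ (τ x) = τ (σ x) :=
  DFunLike.congr_fun h.eq x

theorem commute_ringAut {L : Type*} [Field L] [Finite L] (σ τ : RingAut L) : Commute σ τ := by
  obtain ⟨p, hp⟩ := CharP.exists L
  have : Fact p.Prime := ⟨CharP.char_is_prime L p⟩
  let _ : Algebra (ZMod p) L := ZMod.algebra L p
  let overPrimeField (ρ : RingAut L) : Gal(L/ZMod p) :=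
    AlgEquiv.ofRingEquiv (f := ρ) fun k => RingHom.congr_fun
      (Subsingleton.elim ((ρ : L →+* L).comp (algebraMap (ZMod p) L)) (algebraMap (ZMod p) L)) k
  let _ : CommGroup Gal(L/ZMod p) := IsCyclic.commGroup
  have hcomm : overPrimeField σ * overPrimeField τ = overPrimeField τ * overPrimeField σ :=
    mul_comm _ _
  exact RingEquiv.ext fun x => DFunLike.congr_fun hcomm x

theorem linearIndependent_coprod (M N L : Type*) [MulOneClass M] [MulOneClass N] [CommRing L]
    [IsDomain L] :
    LinearIndependent L fun p : (M →* L) × (N →* L) => (p.1.coprod p.2 : M × N → L) := by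
  refine (linearIndependent_monoidHom (M × N) L).comp _ fun p q hpq => Prod.ext ?_ ?_
  · ext x
    simpa using DFunLike.congr_fun hpq (x, 1)
  · ext y
    simpa using DFunLike.congr_fun hpq (1, y)

end Automorphisms

section FixedField

variable {L : Type*} [Field L] (σ : RingAut L)

/-- The automorphism `σ` as an element of the Galois group of `L` over the fixed field of `σ`. -/
def fixedAut : Gal(L/fixedSubfield σ) :=
  AlgEquiv.ofRingEquiv (f := σ) fun x => x.2

@[simp]
theorem coe_fixedAut : ⇑(fixedAut σ) = σ := rfl

theorem orderOf_fixedAut : orderOf (fixedAut σ) = orderOf σ := by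
  refine orderOf_eq_orderOf_iff.2 fun n => ?_
  simp only [DFunLike.ext'_iff, AlgEquiv.coe_pow, RingAut.coe_pow, coe_fixedAut]
  rfl

theorem fixedField_zpowers_fixedAut :
    IntermediateField.fixedField (Subgroup.zpowers (fixedAut σ)) = ⊥ := by
  refine eq_bot_iff.2 fun x hx => IntermediateField.mem_bot.2 ?_
  exact ⟨⟨x, hx ⟨fixedAut σ, Subgroup.mem_zpowers _⟩⟩, rfl⟩

theorem zpowers_fixedAut [FiniteDimensional (fixedSubfield σ) L] :
    Subgroup.zpowers (fixedAut σ) = ⊤ := by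
  rw [← IntermediateField.fixingSubgroup_fixedField (Subgroup.zpowers (fixedAut σ)),
    fixedField_zpowers_fixedAut, IntermediateField.fixingSubgroup_bot]

theorem isGalois_fixedSubfield [FiniteDimensional (fixedSubfield σ) L] :
    IsGalois (fixedSubfield σ) L :=
  IsGalois.of_fixedField_eq_bot _ _ (by rw [← zpowers_fixedAut, fixedField_zpowers_fixedAut])

theorem finrank_fixedSubfield [FiniteDimensional (fixedSubfield σ) L] :
    Module.finrank (fixedSubfield σ) L = orderOf σ := by
  have := isGalois_fixedSubfield σ
  rw [← IsGalois.card_aut_eq_finrank, ← orderOf_fixedAut, ← Nat.card_zpowers, zpowers_fixedAut,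
    Subgroup.card_top]

theorem fixedNorm_mul (x y : L) : fixedNorm σ (x * y) = fixedNorm σ x * fixedNorm σ y :=
  map_mul _ x y

theorem fixedNorm_apply (x : L) : fixedNorm σ (σ x) = fixedNorm σ x :=
  Algebra.norm_eq_of_algEquiv (fixedAut σ) x

theorem fixedNorm_neg [FiniteDimensional (fixedSubfield σ) L] (x : L) :
    fixedNorm σ (-x) = (-1) ^ orderOf σ * fixedNorm σ x := by
  have norm_neg_one : fixedNorm σ (-1) = (-1) ^ orderOf σ := by
    have h := Algebra.norm_algebraMap (S := L) (-1 : fixedSubfield σ)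
    rwa [finrank_fixedSubfield, map_neg, map_one] at h
  rw [← neg_one_mul, fixedNorm_mul, norm_neg_one]

theorem fixedNorm_div_apply {a : L} (ha : a ≠ 0) : fixedNorm σ (a / σ a) = 1 := by
  have hσa : σ a ≠ 0 := (map_ne_zero σ).2 ha
  have hN : fixedNorm σ (σ a) ≠ 0 := (hσa.isUnit.map (Algebra.norm (fixedSubfield σ))).ne_zero
  refine mul_right_cancel₀ hN ?_
  rw [← fixedNorm_mul, div_mul_cancel₀ a hσa, one_mul, fixedNorm_apply]

theorem coe_fixedNorm [FiniteDimensional (fixedSubfield σ) L] (x : L) :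
    (fixedNorm σ x : L) = ∏ i ∈ Finset.range (orderOf σ), (σ ^ i) x := by
  classical
  have := isGalois_fixedSubfield σ
  have univ_eq : (Finset.univ : Finset Gal(L/fixedSubfield σ)) =
      (Finset.range (orderOf (fixedAut σ))).image (fixedAut σ ^ ·) := by
    rw [image_range_orderOf]
    ext g
    simp [zpowers_fixedAut]
  refine (Algebra.norm_eq_prod_automorphisms (fixedSubfield σ) x).trans ?_
  rw [univ_eq, Finset.prod_image fun i hi j hj => pow_injOn_Iio_orderOf (by simpa using hi)
    (by simpa using hj), orderOf_fixedAut]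
  simp only [AlgEquiv.coe_pow, RingAut.coe_pow, coe_fixedAut]

theorem exists_sum_mul_pow_apply_ne_zero {n : ℕ} (hn : 0 < n) (hσ : n ≤ orderOf σ) {p : ℕ → L}
    (hp : p 0 ≠ 0) : ∃ z, ∑ i ∈ Finset.range n, p i * (σ ^ i) z ≠ 0 := by
  by_contra! hsum
  let χ (i : Fin n) : L →* L := (σ ^ (i : ℕ) : RingAut L)
  have χ_inj : Function.Injective χ := fun i j e => by
    have e' : σ ^ (i : ℕ) = σ ^ (j : ℕ) := RingEquiv.ext fun x => DFunLike.congr_fun e x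
    exact Fin.ext (pow_injOn_Iio_orderOf (i.2.trans_le hσ) (j.2.trans_le hσ) e')
  refine hp (Fintype.linearIndependent_iff.1 ((linearIndependent_monoidHom L L).comp χ χ_inj)
    (fun i => p i) ?_ ⟨0, hn⟩)
  ext z
  have h := hsum z
  rw [← Fin.sum_univ_eq_sum_range fun i => p i * (σ ^ i) z] at h
  simpa [χ] using h

-- Mathlib states Hilbert 90 (`groupCohomology.exists_div_of_norm_eq_one`) only in universe `0`.
theorem exists_div_apply_eq_of_fixedNorm_eq_one [FiniteDimensional (fixedSubfield σ) L] {c : L}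
    (hc : fixedNorm σ c = 1) : ∃ a, a ≠ 0 ∧ a / σ a = c := by
  let p (i : ℕ) : L := ∏ j ∈ Finset.range i, (σ ^ j) c
  have p_zero : p 0 = 1 := Finset.prod_range_zero _
  have p_succ (i : ℕ) : c * σ (p i) = p (i + 1) := by
    simp only [p, Finset.prod_range_succ', map_prod, pow_succ', RingAut.mul_apply, pow_zero,
      RingAut.one_apply, mul_comm]
  have p_orderOf : p (orderOf σ) = 1 :=
    (coe_fixedNorm σ c).symm.trans (congrArg Subtype.val hc)
  have orderOf_pos : 0 < orderOf σ := finrank_fixedSubfield σ ▸ Module.finrank_pos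
  obtain ⟨z, hz⟩ := exists_sum_mul_pow_apply_ne_zero σ orderOf_pos le_rfl (p := p)
    (p_zero ▸ one_ne_zero)
  refine ⟨_, hz, (div_eq_iff ((map_ne_zero σ).2 hz)).2 ?_⟩
  have shift (i : ℕ) : c * σ (p i * (σ ^ i) z) = p (i + 1) * (σ ^ (i + 1)) z := by
    rw [map_mul, ← mul_assoc, p_succ, pow_succ', RingAut.mul_apply]
  have boundary : p (orderOf σ) * (σ ^ orderOf σ) z = p 0 * (σ ^ 0) z := by
    rw [p_orderOf, p_zero, pow_orderOf_eq_one, pow_zero]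
  rw [map_sum, Finset.mul_sum, Finset.sum_congr rfl fun i _ => shift i]
  refine add_right_cancel (b := p 0 * (σ ^ 0) z) ?_
  rw [← Finset.sum_range_succ' (fun i => p i * (σ ^ i) z), Finset.sum_range_succ, boundary]

theorem finiteDimensional_of_fixedNorm_ne_one {η : L} (hη : fixedNorm σ η ≠ 1) :
    FiniteDimensional (fixedSubfield σ) L := by
  by_contra hfin
  exact hη (Algebra.norm_eq_one_of_not_module_finite hfin η)

theorem neg_one_eq_one_iff_ringChar_eq_two (K L : Type*) [Field K] [Field L] [Algebra K L] :
    (-1 : K) = 1 ↔ ringChar L = 2 := by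
  rw [neg_one_eq_one_iff, Algebra.ringChar_eq K L]

end FixedField

section Squares

theorem isSquare_mulEquiv_apply {M N : Type*} [MulOneClass M] [MulOneClass N] (e : M ≃* N) {x : M} :
    IsSquare (e x) ↔ IsSquare x :=
  ⟨fun h => by simpa using h.map e.symm, fun h => h.map e⟩

theorem isSquare_apply_mul_self {L : Type*} [Field L] [Finite L] (σ : RingAut L) (x : L) :
    IsSquare (σ x * x) := by
  classical
  have : Fintype L := Fintype.ofFinite L
  rcases eq_or_ne x 0 with rfl | hx
  · simp
  have hσ : quadraticChar L (σ x) = quadraticChar L x := by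
    simp only [quadraticChar_apply, quadraticCharFun, map_eq_zero,
      isSquare_mulEquiv_apply (σ : L ≃* L) (x := x), ← RingEquiv.coe_toMulEquiv]
  rw [← quadraticChar_one_iff_isSquare (mul_ne_zero ((map_ne_zero σ).2 hx) hx), map_mul, hσ,
    ← sq, quadraticChar_sq_one hx]

theorem isSquare_apply_div_self {L : Type*} [Field L] [Finite L] (σ : RingAut L) (x : L) :
    IsSquare (σ x / x) := by
  rcases eq_or_ne x 0 with rfl | hx
  · simp
  simpa only [mul_div_mul_right _ _ hx] using
    (isSquare_apply_mul_self σ x).div (IsSquare.mul_self x)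

-- `f + 1` divides `f ^ (2 * n + 1) + 1` in the endomorphism ring of the multiplicative group.
theorem exists_map_mul_self_eq_mul_iterate {G : Type*} [CommGroupWithZero G] (f : G →*₀ G) (b : G)
    (n : ℕ) : ∃ x, f x * x = b * f^[2 * n + 1] b := by
  rcases eq_or_ne b 0 with rfl | hb
  · exact ⟨0, by simp⟩
  induction n with
  | zero => exact ⟨b, mul_comm _ _⟩
  | succ n ih =>
    obtain ⟨x, hx⟩ := ih
    have iterate_ne_zero (m : ℕ) : f^[m] b ≠ 0 := by
      induction m with
      | zero => exact hb
      | succ m ih => rwa [Function.iterate_succ_apply', map_ne_zero]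
    have hc := iterate_ne_zero (2 * n + 1)
    refine ⟨x * (f (f^[2 * n + 1] b) / f^[2 * n + 1] b), ?_⟩
    rw [show 2 * (n + 1) + 1 = 2 * n + 1 + 1 + 1 by ring, Function.iterate_succ_apply' f (_ + 1),
      Function.iterate_succ_apply' f (2 * n + 1)]
    set c := f^[2 * n + 1] b
    have hfc : f c ≠ 0 := (map_ne_zero f).2 hc
    calc f (x * (f c / c)) * (x * (f c / c)) = f x * x * (f (f c) / c) := by
          rw [map_mul, map_div₀]
          field_simp
      _ = b * f (f c) := by
          rw [hx]
          field_simp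

theorem exists_apply_mul_self_eq_mul_self {L : Type*} [Field L] {σ : RingAut L}
    (hσ : Odd (orderOf σ)) (b : L) : ∃ x, σ x * x = b * b := by
  obtain ⟨n, hn⟩ := hσ
  obtain ⟨x, hx⟩ := exists_map_mul_self_eq_mul_iterate (σ : L →+* L).toMonoidWithZeroHom b n
  have hb : σ^[2 * n + 1] b = b := by
    rw [← hn, ← RingAut.coe_pow, pow_orderOf_eq_one, RingAut.one_apply]
  exact ⟨x, hx.trans (congrArg (b * ·) hb)⟩

end Squares

section Counting

theorem ncard_map_ne_one {G H : Type*} [Group G] [Finite G] [Group H] {f : G →* H}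
    (hf : Function.Surjective f) (h : H) :
    {g | f g ≠ 1}.ncard = (Nat.card H - 1) * {g | f g = h}.ncard := by
  have fiber : {g | f g = h}.ncard = Nat.card f.ker := by
    obtain ⟨a, rfl⟩ := hf h
    rw [← SetLike.coe_sort_coe, Nat.card_coe_set_eq]
    refine Set.ncard_congr (fun g _ => a⁻¹ * g) (fun g hg => ?_) (fun g g' _ _ => mul_left_cancel)
      fun k hk => ⟨a * k, ?_, inv_mul_cancel_left a k⟩
    · simpa [MonoidHom.mem_ker, inv_mul_eq_one] using hg.symm
    · simpa [MonoidHom.mem_ker] using hk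
  have total : Nat.card f.ker * Nat.card H = Nat.card G := by
    rw [← f.ker.card_mul_index, Subgroup.index_ker, MonoidHom.range_eq_top.2 hf, Subgroup.card_top]
  have compl : {g | f g ≠ 1} = (f.ker : Set G)ᶜ := rfl
  rw [compl, Set.ncard_compl, fiber, ← Nat.card_coe_set_eq, SetLike.coe_sort_coe, ← total,
    Nat.sub_mul, one_mul, mul_comm]

theorem ncard_norm_ne_one (K L : Type*) [Field K] [Field L] [Finite L] [Algebra K L] {k : K}
    (hk : k ≠ 0) :
    {x : L | x ≠ 0 ∧ Algebra.norm K x ≠ 1}.ncard =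
      (Nat.card K - 2) * {x : L | Algebra.norm K x = k}.ncard := by
  have : Finite K := Finite.of_injective _ (algebraMap K L).injective
  have image_val (p : L → Prop) (hp : ∀ x, p x → x ≠ 0) :
      {x | p x}.ncard = {u : Lˣ | p u}.ncard := by
    rw [← Set.ncard_image_of_injective _ Units.val_injective]
    congr 1
    ext x
    exact ⟨fun hx => ⟨Units.mk0 x (hp x hx), hx, rfl⟩, by rintro ⟨u, hu, rfl⟩; exact hu⟩
  rw [image_val _ fun _ h => h.1, image_val _ fun x hx => Algebra.norm_ne_zero_iff.1 (hx ▸ hk)]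
  have h := ncard_map_ne_one (FiniteField.unitsMap_norm_surjective K L) (Units.mk0 k hk)
  rw [Nat.card_units, Nat.sub_sub] at h
  simpa [Units.ext_iff] using h

theorem exists_ne_zero_ne_one_ne_neg_one {K : Type*} [Ring K] (hK : 3 < Nat.card K) :
    ∃ k : K, k ≠ 0 ∧ k ≠ 1 ∧ k ≠ -1 := by
  classical
  have : Finite K := Nat.finite_of_card_ne_zero (by lia)
  have : Fintype K := Fintype.ofFinite K
  rw [Nat.card_eq_fintype_card, ← Finset.card_univ] at hK
  obtain ⟨k, -, hk⟩ := Finset.exists_mem_notMem_of_card_lt_card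
    (Finset.card_le_three (a := (0 : K)) (b := 1) (c := -1) |>.trans_lt hK)
  exact ⟨k, by simpa using hk⟩

end Counting

section Isotopy

variable {S T U : Type*} [AddGroup S] [AddGroup T] [AddGroup U]

theorem Isotopic.symm {f : S → S → S} {g : T → T → T} (h : Isotopic f g) : Isotopic g f := by
  obtain ⟨N₁, N₂, N₃, h⟩ := h
  exact ⟨N₁.symm, N₂.symm, N₃.symm, fun x y => by simp [N₁.symm_apply_eq, h]⟩

theorem Isotopic.trans {f : S → S → S} {g : T → T → T} {k : U → U → U} (h : Isotopic f g)
    (h' : Isotopic g k) : Isotopic f k := by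
  obtain ⟨N₁, N₂, N₃, h⟩ := h
  obtain ⟨M₁, M₂, M₃, h'⟩ := h'
  exact ⟨N₁.trans M₁, N₂.trans M₂, N₃.trans M₃, fun x y => by simp [h, h']⟩

/-- `A` twists the left argument of `f` so that the multiplication becomes commutative. Every
multiplication isotopic to a commutative one has an additive bijective twist, so restrictions on
twists exclude isotopies to Zhou–Pott semifields. -/
def IsCommutingTwist {S : Type*} (f : S → S → S) (A : S → S) : Prop :=
  ∀ x y, f (A x) y = f (A y) x

theorem Isotopic.exists_isCommutingTwist {f : S → S → S} {g : T → T → T} (h : Isotopic f g)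
    (hg : ∀ x y, g x y = g y x) : ∃ A : S ≃+ S, IsCommutingTwist f A := by
  obtain ⟨N₁, N₂, N₃, h⟩ := h
  refine ⟨N₃.trans N₂.symm, fun x y => N₁.injective ?_⟩
  simp [h, hg (N₃ x)]

theorem zhouPottMul_comm {L : Type*} [Field L] (σ τ : RingAut L) (α : L) (x y : L × L) :
    zhouPottMul σ τ α x y = zhouPottMul σ τ α y x := by
  simp only [zhouPottMul, map_add, map_mul, Prod.mk.injEq]
  constructor <;> ring

end Isotopy

section Presemifield

variable {L : Type*} [Field L] {σ τ : RingAut L} {α η : L}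

theorem mul_apply_sub_ne_zero (hη : fixedNorm σ η ≠ 1) {x y : L} (hx : x ≠ 0) (hy : y ≠ 0) :
    x * σ y - η * σ x * y ≠ 0 := by
  intro h
  have hσx : σ x ≠ 0 := (map_ne_zero σ).2 hx
  have hquot : x / y / σ (x / y) = η := by
    rw [map_div₀]
    field_simp
    linear_combination h
  exact hη (hquot ▸ fixedNorm_div_apply σ (div_ne_zero hx hy))

theorem familyMul_ne_zero_of_fst_ne_zero (hστ : Commute σ τ) (h : IsFamilyParam σ τ α η)
    {x y : L × L} (hx : x.1 ≠ 0) (hy : y.1 ≠ 0) : familyMul σ τ α η x y ≠ 0 := by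
  obtain ⟨x₀, x₁⟩ := x
  obtain ⟨y₀, y₁⟩ := y
  intro hxy
  obtain ⟨hfst, hsnd⟩ := Prod.mk_eq_zero.1 hxy
  dsimp only at hx hy hfst hsnd
  have hτx : τ x₀ ≠ 0 := (map_ne_zero τ).2 hx
  have hτy : τ y₀ ≠ 0 := (map_ne_zero τ).2 hy
  obtain ⟨u, rfl⟩ : ∃ u, y₁ = u * τ y₀ := ⟨y₁ / τ y₀, by field_simp⟩
  obtain rfl : x₁ = -(u * τ x₀) := mul_right_cancel₀ hτy (by linear_combination hsnd)
  set z := x₀ * σ y₀ - τ⁻¹ η * σ x₀ * y₀ with hz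
  have hτz : τ z = τ x₀ * σ (τ y₀) - η * σ (τ x₀) * τ y₀ := by
    simp only [hz, map_sub, map_mul, RingAut.inv_apply, RingEquiv.apply_symm_apply,
      ringAut_apply_comm hστ]
  have hz0 : z ≠ 0 := (map_ne_zero τ).1 (hτz ▸ mul_apply_sub_ne_zero h.norm_ne_one hτx hτy)
  have hαz : α * z = σ u * u * τ z := by
    rw [hτz]
    simp only [map_neg, map_mul] at hfst
    linear_combination hfst
  have hu : u ≠ 0 := by
    rintro rfl
    exact mul_ne_zero h.alpha.ne_zero hz0 (by simpa using hαz)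
  exact h.alpha.ne_mul u z hu hz0 (by rw [← mul_div_assoc, eq_div_iff hz0, hαz])

theorem isPresemifield_familyMul (hστ : Commute σ τ) (h : IsFamilyParam σ τ α η) :
    IsPresemifield (familyMul σ τ α η) where
  left_distrib x y z := by
    simp only [familyMul, Prod.fst_add, Prod.snd_add, map_add, Prod.mk_add_mk, Prod.mk.injEq]
    constructor <;> ring
  right_distrib x y z := by
    simp only [familyMul, Prod.fst_add, Prod.snd_add, map_add, Prod.mk_add_mk, Prod.mk.injEq]
    constructor <;> ring
  eq_zero_or_eq_zero := by
    rintro ⟨x₀, x₁⟩ ⟨y₀, y₁⟩ hxy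
    rcases eq_or_ne x₀ 0 with rfl | hx₀ <;> rcases eq_or_ne y₀ 0 with rfl | hy₀
    · have hfst : x₁ * σ y₁ - η * σ x₁ * y₁ = 0 := by simpa [familyMul] using congrArg Prod.fst hxy
      by_contra! hne
      exact mul_apply_sub_ne_zero h.norm_ne_one (by simpa using hne.1) (by simpa using hne.2) hfst
    · have hsnd : x₁ * τ y₀ = 0 := by simpa [familyMul] using congrArg Prod.snd hxy
      exact Or.inl (by simpa [hy₀] using hsnd)
    · have hsnd : τ x₀ * y₁ = 0 := by simpa [familyMul] using congrArg Prod.snd hxy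
      exact Or.inr (by simpa [hx₀] using hsnd)
    · exact absurd hxy (familyMul_ne_zero_of_fst_ne_zero hστ h hx₀ hy₀)

end Presemifield

section Admissible

variable {L : Type*} [Field L] {σ τ : RingAut L} {α : L}

theorem IsFamilyAlpha.mul_apply_div (h : IsFamilyAlpha σ τ α) {c : L} (hc : c ≠ 0) :
    IsFamilyAlpha σ τ (α * (τ c / c)) where
  ne_zero := mul_ne_zero h.ne_zero (div_ne_zero ((map_ne_zero τ).2 hc) hc)
  ne_mul x y hx hy e := by
    have hτc : τ c ≠ 0 := (map_ne_zero τ).2 hc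
    refine h.ne_mul x (y / c) hx (div_ne_zero hy hc) ?_
    rw [map_div₀]
    field_simp at e ⊢
    exact e

theorem isFamilyAlpha_of_not_isSquare [Finite L] (hα : ¬ IsSquare α) : IsFamilyAlpha σ τ α where
  ne_zero := by
    rintro rfl
    exact hα IsSquare.zero
  ne_mul x y _ _ := by
    rintro rfl
    exact hα ((isSquare_apply_mul_self σ x).mul (isSquare_apply_div_self τ y))

theorem IsFamilyAlpha.not_isSquare (h : IsFamilyAlpha σ τ α) (hσ : Odd (orderOf σ)) :
    ¬ IsSquare α := by
  rintro ⟨b, rfl⟩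
  obtain ⟨x, hx⟩ := exists_apply_mul_self_eq_mul_self hσ b
  have hx0 : x ≠ 0 := right_ne_zero_of_mul (hx ▸ h.ne_zero)
  exact h.ne_mul x 1 hx0 one_ne_zero (by simp [hx])

theorem IsFamilyAlpha.isZhouPottParam [Finite L] (h : IsFamilyAlpha σ τ α)
    (hσ : Odd (orderOf σ)) : IsZhouPottParam σ α where
  char_ne_two hchar := h.not_isSquare hσ (FiniteField.isSquare_of_char_two hchar α)
  odd_order := hσ
  not_isSquare := h.not_isSquare hσ

theorem IsZhouPottParam.isFamilyParam_neg_one [Finite L] (h : IsZhouPottParam σ α)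
    (τ : RingAut L) : IsFamilyParam σ τ α (-1) where
  alpha := isFamilyAlpha_of_not_isSquare h.not_isSquare
  norm_ne_one := by
    have norm_one : fixedNorm σ 1 = 1 := map_one _
    rw [fixedNorm_neg, h.odd_order.neg_one_pow, norm_one, mul_one]
    exact (neg_one_eq_one_iff_ringChar_eq_two _ L).not.2 h.char_ne_two

end Admissible

section CommutingTwist

variable {L : Type*} [Field L] {σ τ : RingAut L} {α η : L} {A : L × L → L × L}

theorem IsCommutingTwist.familyMul_apply_zero_right
    (hA : IsCommutingTwist (familyMul σ τ α η) A) (t : L) :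
    A (0, t) = ((A (0, 1)).1 * τ⁻¹ t, τ (A (1, 0)).1 * t) := by
  ext
  · apply τ.injective
    simpa [familyMul] using congrArg Prod.snd (hA (0, t) (0, 1))
  · simpa [familyMul] using congrArg Prod.snd (hA (0, t) (1, 0))

theorem IsCommutingTwist.familyMul_apply_zero_left
    (hA : IsCommutingTwist (familyMul σ τ α η) A) (t : L) :
    A (t, 0) = ((A (1, 0)).1 * t, (A (1, 0)).2 * τ t) := by
  ext
  · apply τ.injective
    have h := congrArg Prod.snd (hA (t, 0) (0, 1))
    rw [hA.familyMul_apply_zero_right 1] at h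
    simpa [familyMul] using h
  · simpa [familyMul] using congrArg Prod.snd (hA (t, 0) (1, 0))

theorem IsCommutingTwist.familyMul_neg_mul_apply (hA : IsCommutingTwist (familyMul σ τ α η) A)
    (hσ : σ ≠ 1) : -η * σ (τ (A (1, 0)).1) = τ (A (1, 0)).1 := by
  obtain ⟨y, hy⟩ : ∃ y, σ y ≠ y := by
    by_contra! hid
    exact hσ (RingEquiv.ext hid)
  have hfst := congrArg Prod.fst (hA (0, 1) (0, y))
  rw [hA.familyMul_apply_zero_right y, hA.familyMul_apply_zero_right 1] at hfst
  simp only [familyMul, map_mul, map_zero, map_one] at hfst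
  refine mul_right_cancel₀ (sub_ne_zero.2 hy) ?_
  linear_combination -hfst

theorem coeff_eq_zero_of_sum_mul_eq_zero {C E F G : L} (hσ : σ ^ 2 ≠ 1) (hτ : τ ≠ 1)
    (h : ∀ u y, C * (τ u * σ y) + E * (σ (τ u) * y) + F * (σ u * τ⁻¹ y) +
      G * (u * σ (τ⁻¹ y)) = 0) : C = 0 := by
  classical
  let χ (ρ : RingAut L) : L →* L := (ρ : L →* L)
  have χ_inj {ρ κ : RingAut L} (e : χ ρ = χ κ) : ρ = κ :=
    RingEquiv.ext fun x => DFunLike.congr_fun e x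
  have h₁ : (χ (σ * τ), χ 1) ≠ (χ τ, χ σ) := fun e => by
    rw [← χ_inj (Prod.ext_iff.1 e).2] at hσ
    exact hσ (one_pow 2)
  have h₂ : (χ σ, χ τ⁻¹) ≠ (χ τ, χ σ) := fun e => by
    have hστ := χ_inj (Prod.ext_iff.1 e).1
    have hτσ : τ⁻¹ = σ := χ_inj (Prod.ext_iff.1 e).2
    exact hσ (by rw [sq, ← mul_inv_cancel τ, hτσ, ← hστ])
  have h₃ : (χ 1, χ (σ * τ⁻¹)) ≠ (χ τ, χ σ) := fun e => hτ (χ_inj (Prod.ext_iff.1 e).1).symm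
  have hsum := linearIndependent_iff.1 (linearIndependent_coprod L L L)
    (Finsupp.single (χ τ, χ σ) C + Finsupp.single (χ (σ * τ), χ 1) E +
      Finsupp.single (χ σ, χ τ⁻¹) F + Finsupp.single (χ 1, χ (σ * τ⁻¹)) G) (by
    ext ⟨u, y⟩
    simpa [χ] using h u y)
  simpa [Finsupp.single_apply, h₁, h₂, h₃] using DFunLike.congr_fun hsum (χ τ, χ σ)

theorem IsCommutingTwist.familyMul_fst_ne_zero (hA : IsCommutingTwist (familyMul σ τ α η) A)
    (hinj : Function.Injective A) (hσ : σ ^ 2 ≠ 1) (hτ : τ ≠ 1) : (A (1, 0)).1 ≠ 0 := by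
  intro hD
  have hC : (A (1, 0)).2 = 0 := by
    refine coeff_eq_zero_of_sum_mul_eq_zero (σ := σ) (τ := τ) (E := -(η * σ (A (1, 0)).2))
      (F := -(α * (A (0, 1)).1)) (G := α * (τ⁻¹ η * σ (A (0, 1)).1)) hσ hτ fun u y => ?_
    have hfst := congrArg Prod.fst (hA (u, 0) (0, y))
    rw [hA.familyMul_apply_zero_left u, hA.familyMul_apply_zero_right y] at hfst
    simp only [familyMul, hD, map_mul, map_zero] at hfst
    linear_combination hfst
  have h10 : A (1, 0) = A (0, 0) := by
    rw [hA.familyMul_apply_zero_left 0, hA.familyMul_apply_zero_left 1, hD, hC]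
    simp
  exact one_ne_zero (congrArg Prod.fst (hinj h10))

theorem IsCommutingTwist.odd_orderOf_and_fixedNorm_eq_neg_one
    (hA : IsCommutingTwist (familyMul σ τ α η) A) (hinj : Function.Injective A) (hσ : σ ^ 2 ≠ 1)
    (hτ : τ ≠ 1) (hη : fixedNorm σ η ≠ 1) : Odd (orderOf σ) ∧ fixedNorm σ η = -1 := by
  have := finiteDimensional_of_fixedNorm_ne_one σ hη
  have hσ1 : σ ≠ 1 := by
    rintro rfl
    exact hσ (one_pow 2)
  have hD : τ (A (1, 0)).1 ≠ 0 := (map_ne_zero τ).2 (hA.familyMul_fst_ne_zero hinj hσ hτ)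
  have hN : fixedNorm σ (-η) = 1 := by
    rw [← fixedNorm_div_apply σ hD]
    congr 1
    rw [eq_div_iff ((map_ne_zero σ).2 hD), hA.familyMul_neg_mul_apply hσ1]
  rw [fixedNorm_neg] at hN
  rcases Nat.even_or_odd (orderOf σ) with heven | hodd
  · rw [heven.neg_one_pow, one_mul] at hN
    exact absurd hN hη
  · rw [hodd.neg_one_pow, neg_one_mul] at hN
    exact ⟨hodd, neg_eq_iff_eq_neg.1 hN⟩

end CommutingTwist

section ZhouPott

theorem isotopic_zhouPottMul_familyMul {L : Type*} [Field L] {σ τ : RingAut L}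
    (hστ : Commute σ τ) (α : L) :
    Isotopic (zhouPottMul σ τ α) (familyMul σ τ⁻¹ α (-1)) := by
  let N : L × L ≃+ L × L := (AddEquiv.prodCongr (AddEquiv.refl L) τ.toAddEquiv).trans
    AddEquiv.prodComm
  have hN (x : L × L) : N x = (τ x.2, x.1) := rfl
  refine ⟨AddEquiv.refl _, N, N, fun x y => ?_⟩
  simp only [AddEquiv.refl_apply, zhouPottMul, familyMul, hN, map_neg, map_one, map_add, map_mul,
    RingAut.inv_apply, RingEquiv.symm_apply_apply, ringAut_apply_comm hστ, Prod.mk.injEq]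
  constructor <;> ring

theorem isotopic_familyMul_mul_div_apply {L : Type*} [Field L] {σ τ : RingAut L}
    (hστ : Commute σ τ) (α η : L) {d : L} (hd : d ≠ 0) :
    Isotopic (familyMul σ τ α (η * (τ d / σ (τ d))))
      (familyMul σ τ (α * (τ (σ d) / σ d)) η) := by
  have hτd : τ d ≠ 0 := (map_ne_zero τ).2 hd
  have hσd : σ d ≠ 0 := (map_ne_zero σ).2 hd
  have hτσd : τ (σ d) ≠ 0 := (map_ne_zero τ).2 hσd
  let scale (u v : Lˣ) : L × L ≃+ L × L := AddEquiv.prodCongr (AddAut.mulLeft u) (AddAut.mulLeft v)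
  have hscale (u v : Lˣ) (x : L × L) : scale u v x = (u * x.1, v * x.2) := rfl
  refine ⟨scale (Units.mk0 _ hτσd) (Units.mk0 _ hτd), AddEquiv.refl _,
    scale (Units.mk0 d hd) (Units.mk0 _ hτd), fun x y => ?_⟩
  have hinv : τ⁻¹ (τ d / τ (σ d)) = d / σ d := by
    rw [← map_div₀]
    exact τ.symm_apply_apply _
  simp only [hscale, AddEquiv.refl_apply, familyMul, map_mul, hinv, Units.val_mk0,
    ringAut_apply_comm hστ, Prod.mk.injEq]
  constructor
  · field_simp
  · ring

theorem isIsotopicToZhouPott_of_fixedNorm_eq_neg_one {L : Type u} [Field L] [Finite L]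
    {σ τ : RingAut L} {α η : L} (hα : IsFamilyAlpha σ τ α) (hσ : Odd (orderOf σ))
    (hη : fixedNorm σ η = -1) : IsIsotopicToZhouPott (familyMul σ τ α η) := by
  have hN : fixedNorm σ (-η) = 1 := by
    rw [fixedNorm_neg, hη, hσ.neg_one_pow, neg_one_mul, neg_neg]
  obtain ⟨b, hb, hbη⟩ := exists_div_apply_eq_of_fixedNorm_eq_one σ hN
  obtain ⟨d, rfl⟩ := τ.surjective b
  have hd : d ≠ 0 := (map_ne_zero τ).1 hb
  let β := α * (τ (σ d) / σ d)
  have hβ : IsZhouPottParam σ β := (hα.mul_apply_div ((map_ne_zero σ).2 hd)).isZhouPottParam hσ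
  have toNegOne : Isotopic (familyMul σ τ α η) (familyMul σ τ β (-1)) := by
    simpa only [hbη, neg_one_mul, neg_neg] using
      isotopic_familyMul_mul_div_apply (commute_ringAut σ τ) α (-1) hd
  have toZhouPott : Isotopic (familyMul σ τ β (-1)) (zhouPottMul σ τ⁻¹ β) := by
    simpa only [inv_inv] using
      (isotopic_zhouPottMul_familyMul (commute_ringAut σ τ⁻¹) β).symm
  exact ⟨L, inferInstance, inferInstance, σ, τ⁻¹, β, hβ, toNegOne.trans toZhouPott⟩

variable {L : Type u} [Field L] [Finite L] {σ τ : RingAut L} {α η : L}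

theorem isIsotopicToZhouPott_familyMul_iff (hσ : σ ^ 2 ≠ 1) (hτ : τ ≠ 1)
    (h : IsFamilyParam σ τ α η) :
    IsIsotopicToZhouPott (familyMul σ τ α η) ↔ Odd (orderOf σ) ∧ fixedNorm σ η = -1 := by
  constructor
  · rintro ⟨F, _, _, σ', τ', α', -, hiso⟩
    obtain ⟨A, hA⟩ := hiso.exists_isCommutingTwist (zhouPottMul_comm σ' τ' α')
    exact hA.odd_orderOf_and_fixedNorm_eq_neg_one A.injective hσ hτ h.norm_ne_one
  · rintro ⟨hodd, hη⟩
    exact isIsotopicToZhouPott_of_fixedNorm_eq_neg_one h.alpha hodd hη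

theorem exists_isFamilyParam_not_isIsotopicToZhouPott (hσ : σ ^ 2 ≠ 1) (hτ : τ ≠ 1)
    (hchar : ringChar L ≠ 2) (hK : 3 < Nat.card (fixedSubfield σ) ∨ Even (orderOf σ)) :
    ∃ α η : L, η ≠ 0 ∧ IsFamilyParam σ τ α η ∧ ¬ IsIsotopicToZhouPott (familyMul σ τ α η) := by
  obtain ⟨k, hk0, hk1, hk⟩ : ∃ k : fixedSubfield σ, k ≠ 0 ∧ k ≠ 1 ∧
      ¬ (Odd (orderOf σ) ∧ k = -1) := by
    rcases hK with hcard | heven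
    · obtain ⟨k, hk0, hk1, hk⟩ := exists_ne_zero_ne_one_ne_neg_one hcard
      exact ⟨k, hk0, hk1, fun h => hk h.2⟩
    · exact ⟨-1, neg_ne_zero.2 one_ne_zero, (neg_one_eq_one_iff_ringChar_eq_two _ L).not.2 hchar,
        fun h => Nat.not_even_iff_odd.2 h.1 heven⟩
  obtain ⟨α, hα⟩ := FiniteField.exists_nonsquare hchar
  obtain ⟨η, rfl⟩ : ∃ η, fixedNorm σ η = k := FiniteField.norm_surjective (fixedSubfield σ) L k
  have hαη : IsFamilyParam σ τ α η := ⟨isFamilyAlpha_of_not_isSquare hα, hk1⟩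
  exact ⟨α, η, Algebra.norm_ne_zero_iff.1 hk0, hαη,
    fun h => hk ((isIsotopicToZhouPott_familyMul_iff hσ hτ hαη).1 h)⟩

theorem ncard_isFamilyParam (hσ : σ ^ 2 ≠ 1) (hτ : τ ≠ 1) (hodd : Odd (orderOf σ))
    (hα : IsFamilyAlpha σ τ α) :
    {η : L | η ≠ 0 ∧ IsFamilyParam σ τ α η}.ncard =
      (Nat.card (fixedSubfield σ) - 2) *
        {η : L | η ≠ 0 ∧ IsFamilyParam σ τ α η ∧
          IsIsotopicToZhouPott (familyMul σ τ α η)}.ncard := by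
  have hchar : (-1 : fixedSubfield σ) ≠ 1 :=
    (neg_one_eq_one_iff_ringChar_eq_two _ L).not.2 (hα.isZhouPottParam hodd).char_ne_two
  have hneg : (-1 : fixedSubfield σ) ≠ 0 := neg_ne_zero.2 one_ne_zero
  convert ncard_norm_ne_one (fixedSubfield σ) L hneg using 3 <;> ext η
  · exact and_congr_right fun _ => ⟨fun h => h.norm_ne_one, fun h => ⟨hα, h⟩⟩
  · constructor
    · rintro ⟨-, h, hzp⟩
      exact ((isIsotopicToZhouPott_familyMul_iff hσ hτ h).1 hzp).2
    · intro (hη : fixedNorm σ η = -1)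
      exact ⟨Algebra.norm_ne_zero_iff.1 (hη.trans_ne hneg), ⟨hα, hη.trans_ne hchar⟩,
        isIsotopicToZhouPott_of_fixedNorm_eq_neg_one hα hodd hη⟩

end ZhouPott

theorem mainTheorem5 {L : Type u} [Field L] [Finite L] (σ τ : RingAut L) :
    -- the family consists of (pre-)semifields
    (∀ α η : L, IsFamilyParam σ τ α η → IsPresemifield (familyMul σ τ α η)) ∧
    -- which members are isotopic to a Zhou–Pott semifield
    (σ ^ 2 ≠ 1 → τ ≠ 1 → ∀ α η : L, IsFamilyParam σ τ α η →
      (IsIsotopicToZhouPott (familyMul σ τ α η) ↔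
        Odd (orderOf σ) ∧ fixedNorm σ η = -1)) ∧
    -- every Zhou–Pott semifield is, up to isotopy, a member of the family
    (∀ α : L, IsZhouPottParam σ α →
      IsFamilyParam σ τ⁻¹ α (-1) ∧
        Isotopic (zhouPottMul σ τ α) (familyMul σ τ⁻¹ α (-1))) ∧
    -- the family contains members that are not isotopic to any Zhou–Pott semifield
    (σ ^ 2 ≠ 1 → τ ≠ 1 → ringChar L ≠ 2 →
      3 < Nat.card (fixedSubfield σ) ∨ Even (orderOf σ) →
      ∃ α η : L, η ≠ 0 ∧ IsFamilyParam σ τ α η ∧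
        ¬ IsIsotopicToZhouPott (familyMul σ τ α η)) ∧
    -- exactly one in `|K| - 2` of the nonzero parameters `η` gives a Zhou–Pott semifield
    (σ ^ 2 ≠ 1 → τ ≠ 1 → ringChar L ≠ 2 → Odd (orderOf σ) →
      ∀ α : L, IsFamilyAlpha σ τ α →
        {η : L | η ≠ 0 ∧ IsFamilyParam σ τ α η}.ncard =
          (Nat.card (fixedSubfield σ) - 2) *
            {η : L | η ≠ 0 ∧ IsFamilyParam σ τ α η ∧
              IsIsotopicToZhouPott (familyMul σ τ α η)}.ncard) := by
  exact ⟨fun _ _ h => isPresemifield_familyMul (commute_ringAut σ τ) h,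
    fun hσ hτ _ _ h => isIsotopicToZhouPott_familyMul_iff hσ hτ h,
    fun α h => ⟨h.isFamilyParam_neg_one τ⁻¹,
      isotopic_zhouPottMul_familyMul (commute_ringAut σ τ) α⟩,
    exists_isFamilyParam_not_isIsotopicToZhouPott,
    fun hσ hτ _ hodd _ hα => ncard_isFamilyParam hσ hτ hodd hα⟩
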